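/- Fix a first-order language without equality, function symbols and constants. Its symbols of arity zero are called propositional symbols, those of positive arity predicate symbols. Formulas are built from atoms and $\top,\bot$ with $\neg,\&,\vee,\supset,\forall,\exists$; there are infinitely many free variables. Let $\mathrm{LJ}$ and $\mathrm{LK}$ be Gentzen's intuitionistic and classical sequent calculi (with cut, and with the axioms $\vdash\top$ and $\bot\vdash$), and let $\mathrm{LJ}^+$ be $\mathrm{LJ}$ extended with the neutralization rule: from $N,\Gamma\vdash\Lambda$ and $\neg N,\Gamma\vdash\Lambda$ infer $\Gamma\vdash\Lambda$, where $N$ is any formula that contains no predicate symbols. A formula $F$ is derivable if the sequent $\vdash F$ is. The formula itself is a positive subformula occurrence of itself; $\&,\vee,\forall,\exists$ and the right side of $\supset$ preserve the sign of an occurrence, while $\neg$ and the left side of $\supset$ reverse it. A formula is unipolar if, for every propositional symbol, its occurrences in the formula are all positive or all negative. Theorem. (1) A unipolar formula is derivable in $\mathrm{LJ}^+$ if and only if it is derivable in $\mathrm{LJ}$. (2) If $A\vee B$ is unipolar and derivable in $\mathrm{LJ}^+$, then $A$ or $B$ is derivable in $\mathrm{LJ}^+$. (3) If $\exists x A(x)$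 is unipolar and derivable in $\mathrm{LJ}^+$, then $A(a)$ is derivable in $\mathrm{LJ}^+$ for some variable $a$. (4) For every unary predicate symbol $P$ and every propositional symbol $R$, the formula $(\exists x P(x)\vee\neg\exists x P(x))\vee R$ is derivable in $\mathrm{LK}$ but not in $\mathrm{LJ}^+$. (5) If the language has at least one predicate symbol, then some formula is derivable in $\mathrm{LK}$ but not in $\mathrm{LJ}^+$. -/

import Mathlib

universe u v

namespace DecAtoms

/-- Variables available under `n` quantifiers. As in Gentzen's calculi, free variables
(`Sum.inl a`, `a : ℕ`) and bound variables (`Sum.inr i`, `i : Fin n`, where `i` is the variable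
bound by the `i`-th enclosing quantifier, counted from the outside) are kept apart. -/
abbrev Var (n : ℕ) : Type := ℕ ⊕ Fin n

/-- First-order formulas, without equality, over the relation symbols of `L`, possibly with `n`
bound variables that are not yet quantified. The formulas proper are those with `n = 0`.
Symbols of arity zero are the propositional symbols, symbols of positive arity are the predicate
symbols. -/
inductive Formula (L : FirstOrder.Language.{u, v}) : ℕ → Type v
  | top {n : ℕ} : Formula L n
  | bot {n : ℕ} : Formula L n
  | prop {n : ℕ} (R : L.Relations 0) : Formula L n
  | pred {n k : ℕ} (P : L.Relations (k + 1)) (t : Fin (k + 1) → Var n) : Formula L n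
  | neg {n : ℕ} (A : Formula L n) : Formula L n
  | and {n : ℕ} (A B : Formula L n) : Formula L n
  | or {n : ℕ} (A B : Formula L n) : Formula L n
  | imp {n : ℕ} (A B : Formula L n) : Formula L n
  | all {n : ℕ} (A : Formula L (n + 1)) : Formula L n
  | ex {n : ℕ} (A : Formula L (n + 1)) : Formula L n

variable {L : FirstOrder.Language.{u, v}}

/-- Replace the outermost bound variable by the free variable `a`; the other bound variables are
renumbered. -/
def Var.inst (a : ℕ) {n : ℕ} : Var (n + 1) → Var n
  | Sum.inl b => Sum.inl b
  | Sum.inr i => Fin.cases (Sum.inl a) Sum.inr i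

namespace Formula

/-- `A.inst a` is `A(a)`: the outermost bound variable of `A` (the one that `all A` and `ex A`
quantify when `A : Formula L 1`) is replaced by the free variable `a`. -/
def inst (a : ℕ) : {n : ℕ} → Formula L (n + 1) → Formula L n
  | _, top => top
  | _, bot => bot
  | _, prop R => prop R
  | _, pred P t => pred P (fun i => (t i).inst a)
  | _, neg A => neg (inst a A)
  | _, and A B => and (inst a A) (inst a B)
  | _, or A B => or (inst a A) (inst a B)
  | _, imp A B => imp (inst a A) (inst a B)
  | _, all A => all (inst a A)
  | _, ex A => ex (inst a A)

/-- The free variable `a` occurs in the formula. -/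
def HasVar (a : ℕ) : {n : ℕ} → Formula L n → Prop
  | _, top => False
  | _, bot => False
  | _, prop _ => False
  | _, pred _ t => ∃ i, t i = Sum.inl a
  | _, neg A => HasVar a A
  | _, and A B => HasVar a A ∨ HasVar a B
  | _, or A B => HasVar a A ∨ HasVar a B
  | _, imp A B => HasVar a A ∨ HasVar a B
  | _, all A => HasVar a A
  | _, ex A => HasVar a A

/-- A formula is propositional if it contains no symbols other than propositional ones. -/
def IsPropositional : {n : ℕ} → Formula L n → Prop
  | _, top => True
  | _, bot => True
  | _, prop _ => True
  | _, pred _ _ => False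
  | _, neg A => IsPropositional A
  | _, and A B => IsPropositional A ∧ IsPropositional B
  | _, or A B => IsPropositional A ∧ IsPropositional B
  | _, imp A B => IsPropositional A ∧ IsPropositional B
  | _, all A => IsPropositional A
  | _, ex A => IsPropositional A

/-- `Occurs R true A`: the propositional symbol `R` has a positive occurrence in `A`;
`Occurs R false A`: it has a negative occurrence in `A`. -/
def Occurs (R : L.Relations 0) : Bool → {n : ℕ} → Formula L n → Prop
  | _, _, top => False
  | _, _, bot => False
  | p, _, prop S => p = true ∧ S = R
  | _, _, pred _ _ => False
  | p, _, neg A => Occurs R (!p) A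
  | p, _, and A B => Occurs R p A ∨ Occurs R p B
  | p, _, or A B => Occurs R p A ∨ Occurs R p B
  | p, _, imp A B => Occurs R (!p) A ∨ Occurs R p B
  | p, _, all A => Occurs R p A
  | p, _, ex A => Occurs R p A

/-- The occurrences of every propositional symbol are all positive or all negative. -/
def IsUnipolar {n : ℕ} (A : Formula L n) : Prop :=
  ∀ R : L.Relations 0, ¬ A.Occurs R false ∨ ¬ A.Occurs R true

end Formula

open Formula

/-- Gentzen's intuitionistic sequent calculus (antecedents are lists of formulas, succedents hold
at most one formula), extended with the neutralization rule for the formulas in `𝒩`. -/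
inductive Deriv (𝒩 : Set (Formula L 0)) : List (Formula L 0) → Option (Formula L 0) → Prop
  | ax (A : Formula L 0) : Deriv 𝒩 [A] (some A)
  | topAx : Deriv 𝒩 [] (some top)
  | botAx : Deriv 𝒩 [bot] none
  | thinL {Γ Λ} (A : Formula L 0) : Deriv 𝒩 Γ Λ → Deriv 𝒩 (A :: Γ) Λ
  | thinR {Γ} (A : Formula L 0) : Deriv 𝒩 Γ none → Deriv 𝒩 Γ (some A)
  | contr {A Γ Λ} : Deriv 𝒩 (A :: A :: Γ) Λ → Deriv 𝒩 (A :: Γ) Λ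
  | exch {Δ A B Γ Λ} : Deriv 𝒩 (Δ ++ A :: B :: Γ) Λ → Deriv 𝒩 (Δ ++ B :: A :: Γ) Λ
  | cut {Γ Δ C Λ} : Deriv 𝒩 Γ (some C) → Deriv 𝒩 (C :: Δ) Λ → Deriv 𝒩 (Γ ++ Δ) Λ
  | andR {Γ A B} : Deriv 𝒩 Γ (some A) → Deriv 𝒩 Γ (some B) → Deriv 𝒩 Γ (some (and A B))
  | andL₁ {A B Γ Λ} : Deriv 𝒩 (A :: Γ) Λ → Deriv 𝒩 (and A B :: Γ) Λ
  | andL₂ {A B Γ Λ} : Deriv 𝒩 (B :: Γ) Λ → Deriv 𝒩 (and A B :: Γ) Λ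
  | orL {A B Γ Λ} : Deriv 𝒩 (A :: Γ) Λ → Deriv 𝒩 (B :: Γ) Λ → Deriv 𝒩 (or A B :: Γ) Λ
  | orR₁ {A B Γ} : Deriv 𝒩 Γ (some A) → Deriv 𝒩 Γ (some (or A B))
  | orR₂ {A B Γ} : Deriv 𝒩 Γ (some B) → Deriv 𝒩 Γ (some (or A B))
  | negR {A Γ} : Deriv 𝒩 (A :: Γ) none → Deriv 𝒩 Γ (some (neg A))
  | negL {A Γ} : Deriv 𝒩 Γ (some A) → Deriv 𝒩 (neg A :: Γ) none
  | impR {A B Γ} : Deriv 𝒩 (A :: Γ) (some B) → Deriv 𝒩 Γ (some (imp A B))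
  | impL {A B Γ Δ Λ} : Deriv 𝒩 Γ (some A) → Deriv 𝒩 (B :: Δ) Λ →
      Deriv 𝒩 (imp A B :: (Γ ++ Δ)) Λ
  | allR {F : Formula L 1} {Γ} (a : ℕ) (hΓ : ∀ G ∈ Γ, ¬ G.HasVar a) (hF : ¬ F.HasVar a) :
      Deriv 𝒩 Γ (some (F.inst a)) → Deriv 𝒩 Γ (some (all F))
  | allL {F : Formula L 1} {Γ Λ} (a : ℕ) : Deriv 𝒩 (F.inst a :: Γ) Λ → Deriv 𝒩 (all F :: Γ) Λ
  | exR {F : Formula L 1} {Γ} (a : ℕ) : Deriv 𝒩 Γ (some (F.inst a)) → Deriv 𝒩 Γ (some (ex F))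
  | exL {F : Formula L 1} {Γ Λ} (a : ℕ) (hΓ : ∀ G ∈ Γ, ¬ G.HasVar a)
      (hΛ : ∀ G ∈ Λ, ¬ G.HasVar a) (hF : ¬ F.HasVar a) :
      Deriv 𝒩 (F.inst a :: Γ) Λ → Deriv 𝒩 (ex F :: Γ) Λ
  | neutral {N Γ Λ} (hN : N ∈ 𝒩) : Deriv 𝒩 (N :: Γ) Λ → Deriv 𝒩 (neg N :: Γ) Λ → Deriv 𝒩 Γ Λ

/-- Derivability of a formula in LJ (no neutralization rule). -/
def LJ (A : Formula L 0) : Prop := Deriv ∅ [] (some A)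

/-- Derivability of a formula in LJ⁺: LJ with neutralization of propositional formulas. -/
def LJPlus (A : Formula L 0) : Prop := Deriv {N | N.IsPropositional} [] (some A)

/-- Gentzen's classical sequent calculus LK; antecedents and succedents are lists of formulas. -/
inductive DerivLK : List (Formula L 0) → List (Formula L 0) → Prop
  | ax (A : Formula L 0) : DerivLK [A] [A]
  | topAx : DerivLK [] [top]
  | botAx : DerivLK [bot] []
  | thinL {Γ Θ} (A : Formula L 0) : DerivLK Γ Θ → DerivLK (A :: Γ) Θ
  | thinR {Γ Θ} (A : Formula L 0) : DerivLK Γ Θ → DerivLK Γ (Θ ++ [A])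
  | contrL {A Γ Θ} : DerivLK (A :: A :: Γ) Θ → DerivLK (A :: Γ) Θ
  | contrR {A Γ Θ} : DerivLK Γ (Θ ++ [A, A]) → DerivLK Γ (Θ ++ [A])
  | exchL {Δ A B Γ Θ} : DerivLK (Δ ++ A :: B :: Γ) Θ → DerivLK (Δ ++ B :: A :: Γ) Θ
  | exchR {Γ Θ A B Λ} : DerivLK Γ (Θ ++ A :: B :: Λ) → DerivLK Γ (Θ ++ B :: A :: Λ)
  | cut {Γ Δ C Θ Λ} : DerivLK Γ (Θ ++ [C]) → DerivLK (C :: Δ) Λ → DerivLK (Γ ++ Δ) (Θ ++ Λ)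
  | andR {Γ Θ A B} : DerivLK Γ (Θ ++ [A]) → DerivLK Γ (Θ ++ [B]) → DerivLK Γ (Θ ++ [and A B])
  | andL₁ {A B Γ Θ} : DerivLK (A :: Γ) Θ → DerivLK (and A B :: Γ) Θ
  | andL₂ {A B Γ Θ} : DerivLK (B :: Γ) Θ → DerivLK (and A B :: Γ) Θ
  | orL {A B Γ Θ} : DerivLK (A :: Γ) Θ → DerivLK (B :: Γ) Θ → DerivLK (or A B :: Γ) Θ
  | orR₁ {A B Γ Θ} : DerivLK Γ (Θ ++ [A]) → DerivLK Γ (Θ ++ [or A B])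
  | orR₂ {A B Γ Θ} : DerivLK Γ (Θ ++ [B]) → DerivLK Γ (Θ ++ [or A B])
  | negR {A Γ Θ} : DerivLK (A :: Γ) Θ → DerivLK Γ (Θ ++ [neg A])
  | negL {A Γ Θ} : DerivLK Γ (Θ ++ [A]) → DerivLK (neg A :: Γ) Θ
  | impR {A B Γ Θ} : DerivLK (A :: Γ) (Θ ++ [B]) → DerivLK Γ (Θ ++ [imp A B])
  | impL {A B Γ Δ Θ Λ} : DerivLK Γ (Θ ++ [A]) → DerivLK (B :: Δ) Λ →
      DerivLK (imp A B :: (Γ ++ Δ)) (Θ ++ Λ)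
  | allR {F : Formula L 1} {Γ Θ} (a : ℕ) (hΓ : ∀ G ∈ Γ, ¬ G.HasVar a)
      (hΘ : ∀ G ∈ Θ, ¬ G.HasVar a) (hF : ¬ F.HasVar a) :
      DerivLK Γ (Θ ++ [F.inst a]) → DerivLK Γ (Θ ++ [all F])
  | allL {F : Formula L 1} {Γ Θ} (a : ℕ) : DerivLK (F.inst a :: Γ) Θ → DerivLK (all F :: Γ) Θ
  | exR {F : Formula L 1} {Γ Θ} (a : ℕ) :
      DerivLK Γ (Θ ++ [F.inst a]) → DerivLK Γ (Θ ++ [ex F])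
  | exL {F : Formula L 1} {Γ Θ} (a : ℕ) (hΓ : ∀ G ∈ Γ, ¬ G.HasVar a)
      (hΘ : ∀ G ∈ Θ, ¬ G.HasVar a) (hF : ¬ F.HasVar a) :
      DerivLK (F.inst a :: Γ) Θ → DerivLK (ex F :: Γ) Θ

/-- Derivability of a formula in LK. -/
def LK (A : Formula L 0) : Prop := DerivLK [] [A]

/-- The formula `∃x P(x)` for a unary predicate symbol `P`. -/
def exPred (P : L.Relations 1) : Formula L 0 := ex (pred P (fun _ => Sum.inr 0))

/-- The formula `(∃x P(x) ∨ ¬∃x P(x)) ∨ R`. -/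
def lemExOr (P : L.Relations 1) (R : L.Relations 0) : Formula L 0 :=
  or (or (exPred P) (neg (exPred P))) (prop R)

end DecAtoms

/-!
In a derivation of `LJ⁺`, replace propositional symbols by `⊤` and `⊥`. A formula without predicate
symbols is then provable or refutable in `LJ`, so neutralizations become cuts and the derivation
becomes one in `LJ`. If the end formula is unipolar, send its negative symbols to `⊤` and all others
to `⊥`: positive occurrences are strengthened and negative ones weakened, so the instance implies
the formula in `LJ`. Disjunction and existence properties are thus inherited from `LJ`, where they
follow from the slash of Kleene and Aczel. For the separation from `LK`, the disjunction property
reduces excluded middle for an atom `P` to `P` or `¬P`, and neither is classically valid.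
-/

namespace DecAtoms

variable {L : FirstOrder.Language.{u, v}} {𝒩 𝒩' : Set (Formula L 0)} {Γ : List (Formula L 0)}
  {Λ : Option (Formula L 0)}

/-- A substitution of formulas for propositional symbols. The formula replacing a symbol is given
at every number `n` of enclosing quantifiers, and does not refer to the variables they bind. -/
structure PropSubst (L : FirstOrder.Language.{u, v}) where
  image : {n : ℕ} → L.Relations 0 → Formula L n
  inst_image (a : ℕ) {n : ℕ} (R : L.Relations 0) : (image R : Formula L (n + 1)).inst a = image R

namespace PropSubst

/-- The identity substitution. -/
protected def id : PropSubst L where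
  image := .prop
  inst_image _ _ _ := by rw [Formula.inst]

open Classical in
/-- The substitution of truth values for propositional symbols that makes exactly the symbols
in `S` true. -/
noncomputable def truthValues (S : Set (L.Relations 0)) : PropSubst L where
  image R := if R ∈ S then .top else .bot
  inst_image _ _ R := by by_cases hR : R ∈ S <;> simp only [hR, if_true, if_false, Formula.inst]

variable {S : Set (L.Relations 0)} {R : L.Relations 0} {n : ℕ}

theorem truthValues_of_mem (hR : R ∈ S) : ((truthValues S).image R : Formula L n) = .top :=
  if_pos hR

theorem truthValues_of_notMem (hR : R ∉ S) : ((truthValues S).image R : Formula L n) = .bot :=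
  if_neg hR

end PropSubst

theorem Var.map_inst (e : ℕ → ℕ) (a : ℕ) {n : ℕ} (x : Var (n + 1)) :
    (x.inst a).map e id = Var.inst (e a) (x.map e id) := by
  rcases x with b | i
  · rfl
  · cases i using Fin.cases <;> rfl

namespace Formula

/-- The number of connectives and quantifiers of a formula, a measure that, unlike the subformula
relation, decreases from a quantified formula to its instances. -/
def size : {n : ℕ} → Formula L n → ℕ
  | _, top => 0
  | _, bot => 0
  | _, prop _ => 0
  | _, pred _ _ => 0
  | _, neg A => size A + 1
  | _, and A B => size A + size B + 1
  | _, or A B => size A + size B + 1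
  | _, imp A B => size A + size B + 1
  | _, all A => size A + 1
  | _, ex A => size A + 1

@[simp]
theorem size_inst (a : ℕ) {n : ℕ} (A : Formula L (n + 1)) : (A.inst a).size = A.size := by
  fun_induction inst a A <;> simp_all only [size]

theorem inst_induction {C : Formula L 0 → Prop} (top : C top) (bot : C bot)
    (prop : ∀ R, C (prop R)) (pred : ∀ {k} (P : L.Relations (k + 1)) t, C (pred P t))
    (neg : ∀ A, C A → C (neg A)) (and : ∀ A B, C A → C B → C (and A B))
    (or : ∀ A B, C A → C B → C (or A B)) (imp : ∀ A B, C A → C B → C (imp A B))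
    (all : ∀ F : Formula L 1, (∀ a, C (F.inst a)) → C (all F))
    (ex : ∀ F : Formula L 1, (∀ a, C (F.inst a)) → C (ex F)) (A : Formula L 0) : C A := by
  induction A using (measure Formula.size).wf.induction with
  | _ A ih =>
    replace ih (B : Formula L 0) (h : B.size < A.size) : C B := ih B h
    cases A with
    | top => exact top
    | bot => exact bot
    | prop R => exact prop R
    | pred P t => exact pred P t
    | neg A => exact neg A (ih A (by simp [size]))
    | and A B => exact and A B (ih A (by grind [size])) (ih B (by grind [size]))
    | or A B => exact or A B (ih A (by grind [size])) (ih B (by grind [size]))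
    | imp A B => exact imp A B (ih A (by grind [size])) (ih B (by grind [size]))
    | all F => exact all F fun a => ih (F.inst a) (by simp [size])
    | ex F => exact ex F fun a => ih (F.inst a) (by simp [size])

theorem isPropositional_inst (a : ℕ) {n : ℕ} (A : Formula L (n + 1)) :
    (A.inst a).IsPropositional ↔ A.IsPropositional := by
  fun_induction inst a A <;> simp_all only [IsPropositional]

theorem occurs_inst (R : L.Relations 0) (p : Bool) (a : ℕ) {n : ℕ} (A : Formula L (n + 1)) :
    (A.inst a).Occurs R p ↔ A.Occurs R p := by
  fun_induction inst a A generalizing p <;> simp_all only [Occurs]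

theorem finite_setOf_hasVar {n : ℕ} (A : Formula L n) : {a | A.HasVar a}.Finite := by
  induction A with
  | top | bot | prop => exact Set.finite_empty
  | pred _ t => exact (Set.finite_range t).preimage (f := Sum.inl) Sum.inl_injective.injOn
  | neg _ ih | all _ ih | ex _ ih => exact ih
  | and _ _ ihA ihB | or _ _ ihA ihB | imp _ _ ihA ihB => exact ihA.union ihB

theorem exists_forall_mem_not_hasVar {n : ℕ} (Δ : List (Formula L n)) :
    ∃ a, ∀ G ∈ Δ, ¬ G.HasVar a := by
  have hfin : (⋃ G ∈ {G | G ∈ Δ}, {a | G.HasVar a}).Finite :=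
    Δ.finite_toSet.biUnion fun G _ => G.finite_setOf_hasVar
  simpa using hfin.exists_notMem

theorem exists_not_hasVar {n : ℕ} (A : Formula L n) : ∃ a, ¬ A.HasVar a :=
  A.finite_setOf_hasVar.exists_notMem

/-- Simultaneous substitution of formulas for the propositional symbols, by `σ`, and of variables
for the free variables, by `e`. -/
def subst (σ : PropSubst L) (e : ℕ → ℕ) : {n : ℕ} → Formula L n → Formula L n
  | _, top => top
  | _, bot => bot
  | _, prop R => σ.image R
  | _, pred P t => pred P (fun i => (t i).map e id)
  | _, neg A => neg (subst σ e A)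
  | _, and A B => and (subst σ e A) (subst σ e B)
  | _, or A B => or (subst σ e A) (subst σ e B)
  | _, imp A B => imp (subst σ e A) (subst σ e B)
  | _, all A => all (subst σ e A)
  | _, ex A => ex (subst σ e A)

@[simp]
theorem subst_id {n : ℕ} (A : Formula L n) : A.subst .id id = A := by
  induction A <;> simp_all [subst, PropSubst.id]

theorem subst_congr (σ : PropSubst L) {e f : ℕ → ℕ} {n : ℕ} (A : Formula L n)
    (h : ∀ a, A.HasVar a → e a = f a) : A.subst σ e = A.subst σ f := by
  induction A with
  | top | bot | prop => rfl
  | pred P t =>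
    simp only [subst, pred.injEq, heq_eq_eq, true_and]
    funext i
    cases hi : t i with
    | inl b => simp only [Sum.map_inl, h b ⟨i, hi⟩]
    | inr b => rfl
  | neg A ih | all A ih | ex A ih => simp only [subst, ih h]
  | and A B ihA ihB | or A B ihA ihB | imp A B ihA ihB =>
    simp only [subst, ihA fun a ha => h a (.inl ha), ihB fun a ha => h a (.inr ha)]

theorem subst_inst (σ : PropSubst L) (e : ℕ → ℕ) (a : ℕ) {n : ℕ} (A : Formula L (n + 1)) :
    (A.inst a).subst σ e = (A.subst σ e).inst (e a) := by
  fun_induction inst a A <;> simp_all only [subst, inst, PropSubst.inst_image, Var.map_inst]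

variable {σ : PropSubst L} {e : ℕ → ℕ} {a : ℕ}

theorem subst_update (b : ℕ) {n : ℕ} {A : Formula L n} (h : ¬ A.HasVar a) :
    A.subst σ (Function.update e a b) = A.subst σ e :=
  subst_congr σ A fun c hc => Function.update_of_ne (by rintro rfl; exact h hc) _ _

theorem subst_update_inst (b : ℕ) {n : ℕ} {F : Formula L (n + 1)} (h : ¬ F.HasVar a) :
    (F.inst a).subst σ (Function.update e a b) = (F.subst σ e).inst b := by
  rw [subst_inst, Function.update_self, subst_update b h]

theorem map_subst_update (b : ℕ) (h : ∀ G ∈ Γ, ¬ G.HasVar a) :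
    Γ.map (subst σ (Function.update e a b)) = Γ.map (subst σ e) :=
  List.map_congr_left fun G hG => subst_update b (h G hG)

theorem option_map_subst_update (b : ℕ) (h : ∀ G ∈ Λ, ¬ G.HasVar a) :
    Λ.map (subst σ (Function.update e a b)) = Λ.map (subst σ e) :=
  Option.map_congr fun G hG => subst_update b (h G hG)

/-- The truth value of a formula in the one-element structure in which the relation symbols have
the truth values `v`. Quantifiers are void there. -/
def Holds (v : ∀ k, L.Relations k → Prop) : {n : ℕ} → Formula L n → Prop
  | _, top => True
  | _, bot => False
  | _, prop R => v 0 R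
  | _, pred P _ => v _ P
  | _, neg A => ¬ Holds v A
  | _, and A B => Holds v A ∧ Holds v B
  | _, or A B => Holds v A ∨ Holds v B
  | _, imp A B => Holds v A → Holds v B
  | _, all A => Holds v A
  | _, ex A => Holds v A

theorem holds_inst (v : ∀ k, L.Relations k → Prop) (a : ℕ) {n : ℕ} (A : Formula L (n + 1)) :
    (A.inst a).Holds v ↔ A.Holds v := by
  fun_induction inst a A <;> simp_all only [Holds]

end Formula

open Formula

/-- The neutralization rule for `N` is admissible in the calculus that neutralizes `𝒩`. -/
def Neutralizable (𝒩 : Set (Formula L 0)) (N : Formula L 0) : Prop :=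
  ∀ ⦃Γ Λ⦄, Deriv 𝒩 (N :: Γ) Λ → Deriv 𝒩 (N.neg :: Γ) Λ → Deriv 𝒩 Γ Λ

/-- The formula `A` is provable, or refutable in the sense that it entails the empty succedent.
Neutralization of such a formula reduces to a cut. -/
def Decided (𝒩 : Set (Formula L 0)) (A : Formula L 0) : Prop :=
  Deriv 𝒩 [] (some A) ∨ Deriv 𝒩 [A] none

namespace Deriv

theorem allR_of_forall_inst {F : Formula L 1} (h : ∀ a, Deriv 𝒩 Γ (some (F.inst a))) :
    Deriv 𝒩 Γ (some F.all) := by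
  obtain ⟨a, ha⟩ := exists_forall_mem_not_hasVar (F.all :: Γ)
  obtain ⟨hF, hΓ⟩ := List.forall_mem_cons.1 ha
  exact .allR a hΓ hF (h a)

theorem exL_of_forall_inst {F : Formula L 1} (h : ∀ a, Deriv 𝒩 (F.inst a :: Γ) Λ) :
    Deriv 𝒩 (F.ex :: Γ) Λ := by
  obtain ⟨a, ha⟩ := exists_forall_mem_not_hasVar (F.ex :: (Γ ++ Λ.toList))
  obtain ⟨hF, ha⟩ := List.forall_mem_cons.1 ha
  obtain ⟨hΓ, hΛ⟩ := List.forall_mem_append.1 ha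
  exact .exL a hΓ (fun G hG => hΛ G (Option.mem_toList.2 hG)) hF (h a)

theorem subst {σ : PropSubst L} (h𝒩 : ∀ N ∈ 𝒩, ∀ e, Neutralizable 𝒩' (N.subst σ e))
    (d : Deriv 𝒩 Γ Λ) (e : ℕ → ℕ) :
    Deriv 𝒩' (Γ.map (Formula.subst σ e)) (Λ.map (Formula.subst σ e)) := by
  induction d generalizing e with
  | ax | topAx | botAx => constructor
  | thinL A _ ih => exact .thinL _ (ih e)
  | thinR A _ ih => exact .thinR _ (ih e)
  | contr _ ih => exact .contr (ih e)
  | exch _ ih =>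
    simp only [List.map_append, List.map_cons] at ih ⊢
    exact .exch (ih e)
  | cut _ _ ih₁ ih₂ => exact List.map_append ▸ .cut (ih₁ e) (ih₂ e)
  | andR _ _ ih₁ ih₂ => exact .andR (ih₁ e) (ih₂ e)
  | andL₁ _ ih => exact .andL₁ (ih e)
  | andL₂ _ ih => exact .andL₂ (ih e)
  | orL _ _ ih₁ ih₂ => exact .orL (ih₁ e) (ih₂ e)
  | orR₁ _ ih => exact .orR₁ (ih e)
  | orR₂ _ ih => exact .orR₂ (ih e)
  | negR _ ih => exact .negR (ih e)
  | negL _ ih => exact .negL (ih e)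
  | impR _ ih => exact .impR (ih e)
  | impL _ _ ih₁ ih₂ =>
    rw [List.map_cons, List.map_append]
    exact .impL (ih₁ e) (ih₂ e)
  | allR a hΓ hF _ ih =>
    refine .allR_of_forall_inst fun b => ?_
    simpa only [map_subst_update b hΓ, Option.map_some, subst_update_inst b hF]
      using ih (Function.update e a b)
  | @allL F _ _ a _ ih => exact .allL (e a) (subst_inst σ e a F ▸ ih e)
  | @exR F _ a _ ih => exact .exR (e a) (subst_inst σ e a F ▸ ih e)
  | exL a hΓ hΛ hF _ ih =>
    refine .exL_of_forall_inst fun b => ?_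
    simpa only [List.map_cons, map_subst_update b hΓ, option_map_subst_update b hΛ,
      subst_update_inst b hF] using ih (Function.update e a b)
  | neutral hN _ _ ih₁ ih₂ => exact h𝒩 _ hN e (ih₁ e) (ih₂ e)

section Monotonicity

variable {A A' B B' : Formula L 0} {F F' : Formula L 1}

theorem neg_mono (h : Deriv 𝒩 [A'] (some A)) : Deriv 𝒩 [A.neg] (some A'.neg) :=
  .negR (.exch (Δ := []) (.negL h))

theorem and_mono (hA : Deriv 𝒩 [A] (some A')) (hB : Deriv 𝒩 [B] (some B')) :
    Deriv 𝒩 [A.and B] (some (A'.and B')) :=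
  .andR (.andL₁ hA) (.andL₂ hB)

theorem or_mono (hA : Deriv 𝒩 [A] (some A')) (hB : Deriv 𝒩 [B] (some B')) :
    Deriv 𝒩 [A.or B] (some (A'.or B')) :=
  .orL (.orR₁ hA) (.orR₂ hB)

theorem imp_mono (hA : Deriv 𝒩 [A'] (some A)) (hB : Deriv 𝒩 [B] (some B')) :
    Deriv 𝒩 [A.imp B] (some (A'.imp B')) :=
  .impR (.exch (Δ := []) (.impL (Γ := [A']) (Δ := []) hA hB))

theorem all_mono (h : ∀ a, Deriv 𝒩 [F.inst a] (some (F'.inst a))) :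
    Deriv 𝒩 [F.all] (some F'.all) :=
  .allR_of_forall_inst fun a => .allL a (h a)

theorem ex_mono (h : ∀ a, Deriv 𝒩 [F.inst a] (some (F'.inst a))) :
    Deriv 𝒩 [F.ex] (some F'.ex) :=
  .exL_of_forall_inst fun a => .exR a (h a)

theorem subst_mono {σ τ : PropSubst L} (A : Formula L 0) (e : ℕ → ℕ)
    (hpos : ∀ R, A.Occurs R true → Deriv 𝒩 [σ.image R] (some (τ.image R)))
    (hneg : ∀ R, A.Occurs R false → Deriv 𝒩 [τ.image R] (some (σ.image R))) :
    Deriv 𝒩 [A.subst σ e] (some (A.subst τ e)) := by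
  induction A using inst_induction generalizing σ τ e with
  | top | bot | pred => exact .ax _
  | prop R => exact hpos R ⟨rfl, rfl⟩
  | neg A ih => exact .neg_mono (ih e hneg hpos)
  | and A B ihA ihB =>
    exact .and_mono (ihA e (fun R h => hpos R (.inl h)) fun R h => hneg R (.inl h))
      (ihB e (fun R h => hpos R (.inr h)) fun R h => hneg R (.inr h))
  | or A B ihA ihB =>
    exact .or_mono (ihA e (fun R h => hpos R (.inl h)) fun R h => hneg R (.inl h))
      (ihB e (fun R h => hpos R (.inr h)) fun R h => hneg R (.inr h))
  | imp A B ihA ihB =>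
    exact .imp_mono (ihA e (fun R h => hneg R (.inl h)) fun R h => hpos R (.inl h))
      (ihB e (fun R h => hpos R (.inr h)) fun R h => hneg R (.inr h))
  | all F ih =>
    obtain ⟨a, ha⟩ := F.exists_not_hasVar
    refine .all_mono fun b => ?_
    simpa only [subst_update_inst b ha] using ih a (Function.update e a b)
      (fun R h => hpos R ((occurs_inst R _ a F).1 h)) fun R h => hneg R ((occurs_inst R _ a F).1 h)
  | ex F ih =>
    obtain ⟨a, ha⟩ := F.exists_not_hasVar
    refine .ex_mono fun b => ?_
    simpa only [subst_update_inst b ha] using ih a (Function.update e a b)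
      (fun R h => hpos R ((occurs_inst R _ a F).1 h)) fun R h => hneg R ((occurs_inst R _ a F).1 h)

end Monotonicity

theorem holds (v : ∀ k, L.Relations k → Prop) (d : Deriv 𝒩 Γ Λ) (hΓ : ∀ G ∈ Γ, G.Holds v) :
    ∃ G ∈ Λ, G.Holds v := by
  induction d with
  | @neutral N Γ Λ _ _ _ ih₁ ih₂ =>
    by_cases hN : N.Holds v
    · exact ih₁ (List.forall_mem_cons.2 ⟨hN, hΓ⟩)
    · exact ih₂ (List.forall_mem_cons.2 ⟨hN, hΓ⟩)
  | ax | topAx | botAx => simp_all [Holds]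
  | _ =>
    simp only [List.forall_mem_cons, List.forall_mem_append, Option.mem_def, Option.some.injEq,
      exists_eq_left', Holds, holds_inst] at *
    grind

end Deriv

namespace Decided

variable {A B : Formula L 0} {F : Formula L 1} {a : ℕ}

theorem neutralizable (h : Decided 𝒩 A) : Neutralizable 𝒩 A := fun _ _ hA hnegA =>
  h.elim (fun d => .cut (Γ := []) d hA) fun d => .cut (Γ := []) (.negR d) hnegA

theorem neg (h : Decided 𝒩 A) : Decided 𝒩 A.neg :=
  h.symm.imp .negR .negL

theorem and (hA : Decided 𝒩 A) (hB : Decided 𝒩 B) : Decided 𝒩 (A.and B) := by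
  rcases hA with hA | hA
  · exact hB.imp (.andR hA) .andL₂
  · exact .inr (.andL₁ hA)

theorem or (hA : Decided 𝒩 A) (hB : Decided 𝒩 B) : Decided 𝒩 (A.or B) := by
  rcases hA with hA | hA
  · exact .inl (.orR₁ hA)
  · exact hB.imp .orR₂ (.orL hA)

theorem imp (hA : Decided 𝒩 A) (hB : Decided 𝒩 B) : Decided 𝒩 (A.imp B) := by
  rcases hA with hA | hA
  · exact Or.imp (fun hB => .impR (.thinL A hB)) (.impL (Γ := []) hA) hB
  · exact .inl (.impR (.thinR B hA))

theorem all (hF : ¬ F.HasVar a) (h : Decided 𝒩 (F.inst a)) : Decided 𝒩 F.all :=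
  Or.imp (.allR a (List.forall_mem_nil _) hF) (.allL a) h

theorem ex (hF : ¬ F.HasVar a) (h : Decided 𝒩 (F.inst a)) : Decided 𝒩 F.ex :=
  Or.imp (.exR a) (.exL a (List.forall_mem_nil _) nofun hF) h

theorem subst {σ : PropSubst L} (hσ : ∀ R, Decided 𝒩 (σ.image R)) {N : Formula L 0}
    (hN : N.IsPropositional) (e : ℕ → ℕ) : Decided 𝒩 (N.subst σ e) := by
  induction N using inst_induction generalizing e with
  | top => exact .inl .topAx
  | bot => exact .inr .botAx
  | prop R => exact hσ R
  | pred P t => exact hN.elim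
  | neg A ih => exact (ih hN e).neg
  | and A B ihA ihB => exact (ihA hN.1 e).and (ihB hN.2 e)
  | or A B ihA ihB => exact (ihA hN.1 e).or (ihB hN.2 e)
  | imp A B ihA ihB => exact (ihA hN.1 e).imp (ihB hN.2 e)
  | all F ih =>
    obtain ⟨a, ha⟩ := F.exists_not_hasVar
    obtain ⟨b, hb⟩ := (F.subst σ e).exists_not_hasVar
    refine .all hb ?_
    rw [← subst_update_inst b ha]
    exact ih a ((isPropositional_inst a F).2 hN) _
  | ex F ih =>
    obtain ⟨a, ha⟩ := F.exists_not_hasVar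
    obtain ⟨b, hb⟩ := (F.subst σ e).exists_not_hasVar
    refine .ex hb ?_
    rw [← subst_update_inst b ha]
    exact ih a ((isPropositional_inst a F).2 hN) _

theorem truthValues (S : Set (L.Relations 0)) (R : L.Relations 0) :
    Decided 𝒩 ((PropSubst.truthValues S).image R) := by
  by_cases hR : R ∈ S
  · exact .inl (PropSubst.truthValues_of_mem hR ▸ .topAx)
  · exact .inr (PropSubst.truthValues_of_notMem hR ▸ .botAx)

end Decided

theorem LJ.ljPlus {A : Formula L 0} (h : LJ A) : LJPlus A := by
  have d : Deriv {N | N.IsPropositional} [] (some (A.subst .id id)) :=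
    Deriv.subst (fun _ hN => hN.elim) h id
  rwa [subst_id] at d

theorem LJPlus.lj_subst_truthValues {A : Formula L 0} (h : LJPlus A) (S : Set (L.Relations 0)) :
    LJ (A.subst (.truthValues S) id) :=
  Deriv.subst (fun _ hN e => (Decided.subst (.truthValues S) hN e).neutralizable) h id

theorem deriv_subst_truthValues_of_isUnipolar {A : Formula L 0} (hA : A.IsUnipolar) :
    Deriv 𝒩 [A.subst (.truthValues {R | A.Occurs R false}) id] (some A) := by
  have h : Deriv 𝒩 [A.subst (.truthValues {R | A.Occurs R false}) id] (some (A.subst .id id)) := by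
    refine .subst_mono A id (fun R hR => ?_) fun R hR => ?_
    · rw [PropSubst.truthValues_of_notMem ((hA R).resolve_right (not_not_intro hR))]
      exact .thinR _ .botAx
    · rw [PropSubst.truthValues_of_mem hR]
      exact .thinL _ .topAx
  rwa [subst_id] at h

theorem LJPlus.lj {A : Formula L 0} (hA : A.IsUnipolar) (h : LJPlus A) : LJ A :=
  .cut (Γ := []) (h.lj_subst_truthValues _) (deriv_subst_truthValues_of_isUnipolar hA)

/-- The slash of Kleene and Aczel, for `LJ` without assumptions: a strengthening of derivability
that has the disjunction and existence properties by definition. -/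
def Slash : Formula L 0 → Prop
  | .top => True
  | .bot => False
  | .prop R => LJ (.prop R)
  | .pred P t => LJ (.pred P t)
  | .neg A => LJ A.neg ∧ ¬ Slash A
  | .and A B => Slash A ∧ Slash B
  | .or A B => Slash A ∨ Slash B
  | .imp A B => LJ (A.imp B) ∧ (Slash A → Slash B)
  | .all F => LJ F.all ∧ ∀ a, Slash (F.inst a)
  | .ex F => ∃ a, Slash (F.inst a)
termination_by A => A.size
decreasing_by all_goals simp only [size, size_inst]; omega

theorem Slash.lj {A : Formula L 0} (h : Slash A) : LJ A := by
  induction A using inst_induction with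
  | top => exact .topAx
  | bot => simp only [Slash] at h
  | prop R | pred P t => rwa [Slash] at h
  | neg A | imp A B | all F => rw [Slash] at h; exact h.1
  | and A B ihA ihB => rw [Slash] at h; exact .andR (ihA h.1) (ihB h.2)
  | or A B ihA ihB => rw [Slash] at h; exact h.elim (.orR₁ ∘ ihA) (.orR₂ ∘ ihB)
  | ex F ih =>
    rw [Slash] at h
    obtain ⟨a, ha⟩ := h
    exact .exR a (ih a ha)

theorem Deriv.cut_antecedent (d : Deriv 𝒩 Γ Λ) (h : ∀ G ∈ Γ, Deriv 𝒩 [] (some G)) :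
    Deriv 𝒩 [] Λ := by
  induction Γ with
  | nil => exact d
  | cons G Γ ih =>
    obtain ⟨hG, hΓ⟩ := List.forall_mem_cons.1 h
    exact ih (.cut (Γ := []) hG d) hΓ

theorem Deriv.lj_subst_of_slash {A : Formula L 0} {σ : PropSubst L} {e : ℕ → ℕ}
    (d : Deriv ∅ Γ (some A)) (h : ∀ G ∈ Γ, Slash (G.subst σ e)) : LJ (A.subst σ e) :=
  (d.subst (fun _ hN => hN.elim) e).cut_antecedent (List.forall_mem_map.2 fun G hG => (h G hG).lj)

theorem forall_mem_slash_subst_update {σ : PropSubst L} {e : ℕ → ℕ} {a : ℕ} (b : ℕ)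
    (hΓ : ∀ G ∈ Γ, ¬ G.HasVar a) (h : ∀ G ∈ Γ, Slash (G.subst σ e)) :
    ∀ G ∈ Γ, Slash (G.subst σ (Function.update e a b)) :=
  fun G hG => (subst_update b (hΓ G hG)).symm ▸ h G hG

theorem Deriv.slash_subst {σ : PropSubst L} (d : Deriv ∅ Γ Λ) (e : ℕ → ℕ)
    (h : ∀ G ∈ Γ, Slash (G.subst σ e)) : ∃ G ∈ Λ, Slash (G.subst σ e) := by
  induction d generalizing e with
  | ax | topAx | botAx => simp_all [Formula.subst, Slash]
  | thinL _ _ ih | thinR _ _ ih | contr _ ih | exch _ ih | andL₁ _ ih | andL₂ _ ih | orR₁ _ ih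
  | orR₂ _ ih | negL _ ih | allL _ _ ih | exR _ _ ih =>
    replace ih := ih e
    simp only [List.forall_mem_cons, List.forall_mem_append, Option.mem_def, Option.some.injEq,
      exists_eq_left', Formula.subst, subst_inst, Slash] at *
    grind
  | cut _ _ ih₁ ih₂ | andR _ _ ih₁ ih₂ | orL _ _ ih₁ ih₂ | impL _ _ ih₁ ih₂ =>
    replace ih₁ := ih₁ e
    replace ih₂ := ih₂ e
    simp only [List.forall_mem_cons, List.forall_mem_append, Option.mem_def, Option.some.injEq,
      exists_eq_left', Formula.subst, Slash] at *
    grind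
  | @negR A _ d ih =>
    have hlj := d.negR.lj_subst_of_slash h
    have hA : ¬ Slash (A.subst σ e) := fun hA => by
      simpa using ih e (List.forall_mem_cons.2 ⟨hA, h⟩)
    simpa [Formula.subst, Slash] using And.intro hlj hA
  | @impR A B _ d ih =>
    have hlj := d.impR.lj_subst_of_slash h
    have hAB : Slash (A.subst σ e) → Slash (B.subst σ e) := fun hA => by
      simpa using ih e (List.forall_mem_cons.2 ⟨hA, h⟩)
    simpa [Formula.subst, Slash] using And.intro hlj hAB
  | @allR F _ a hΓ hF d ih =>
    have hlj := (d.allR a hΓ hF).lj_subst_of_slash h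
    have hinst (b : ℕ) : Slash ((F.subst σ e).inst b) := by
      simpa [subst_update_inst b hF] using ih _ (forall_mem_slash_subst_update b hΓ h)
    simpa [Formula.subst, Slash] using And.intro hlj hinst
  | exL a hΓ hΛ hF _ ih =>
    simp only [List.forall_mem_cons, Formula.subst, Slash] at h
    obtain ⟨⟨b, hb⟩, h⟩ := h
    rw [← subst_update_inst b hF] at hb
    obtain ⟨G, hG, hS⟩ := ih _ (List.forall_mem_cons.2 ⟨hb, forall_mem_slash_subst_update b hΓ h⟩)
    exact ⟨G, hG, subst_update b (hΛ G hG) ▸ hS⟩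
  | neutral hN => exact hN.elim

theorem LJ.slash {A : Formula L 0} (h : LJ A) : Slash A := by
  simpa using Deriv.slash_subst (σ := .id) h id (List.forall_mem_nil _)

theorem LJ.or_elim {A B : Formula L 0} (h : LJ (A.or B)) : LJ A ∨ LJ B := by
  have hAB := h.slash
  rw [Slash] at hAB
  exact hAB.imp Slash.lj Slash.lj

theorem LJ.exists_inst {A : Formula L 1} (h : LJ A.ex) : ∃ a, LJ (A.inst a) := by
  have hA := h.slash
  rw [Slash] at hA
  exact hA.imp fun _ => Slash.lj

theorem LJPlus.or_elim {A B : Formula L 0} (hAB : (A.or B).IsUnipolar) (h : LJPlus (A.or B)) :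
    LJPlus A ∨ LJPlus B :=
  (h.lj hAB).or_elim.imp LJ.ljPlus LJ.ljPlus

theorem LJPlus.exists_inst {A : Formula L 1} (hA : A.ex.IsUnipolar) (h : LJPlus A.ex) :
    ∃ a, LJPlus (A.inst a) :=
  (h.lj hA).exists_inst.imp fun _ => LJ.ljPlus

theorem LJPlus.holds {A : Formula L 0} (h : LJPlus A) (v : ∀ k, L.Relations k → Prop) :
    A.Holds v := by
  simpa using Deriv.holds v h (List.forall_mem_nil _)

theorem lk_em (A : Formula L 0) : LK (A.or A.neg) := by
  have hAA : DerivLK [] [A, A.neg] := .negR (Θ := [A]) (.ax A)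
  have hA : DerivLK [] [A.or A.neg, A] := .exchR (Θ := []) (Λ := []) (.orR₂ (Θ := [A]) hAA)
  exact .contrR (Θ := []) (.orR₁ (Θ := [A.or A.neg]) hA)

theorem not_ljPlus_em {A : Formula L 0} (hA : (A.or A.neg).IsUnipolar)
    {v w : ∀ k, L.Relations k → Prop} (hv : ¬ A.Holds v) (hw : A.Holds w) :
    ¬ LJPlus (A.or A.neg) := fun h =>
  (h.or_elim hA).elim (fun h => hv (h.holds v)) fun h => h.holds w hw

theorem not_ljPlus_em_pred {k : ℕ} (P : L.Relations (k + 1)) (t : Fin (k + 1) → Var 0) :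
    ¬ LJPlus ((pred P t).or (pred P t).neg) :=
  not_ljPlus_em (v := fun _ _ => False) (w := fun _ _ => True)
    (fun _ => .inl (by simp only [Occurs, or_self, not_false_eq_true])) not_false trivial

theorem not_ljPlus_em_exPred (P : L.Relations 1) :
    ¬ LJPlus ((exPred P).or (exPred P).neg) :=
  not_ljPlus_em (v := fun _ _ => False) (w := fun _ _ => True)
    (fun _ => .inl (by simp only [exPred, Occurs, or_self, not_false_eq_true])) not_false trivial

theorem lk_lemExOr (P : L.Relations 1) (R : L.Relations 0) : LK (lemExOr P R) :=
  .orR₁ (Θ := []) (lk_em (exPred P))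

theorem not_ljPlus_lemExOr (P : L.Relations 1) (R : L.Relations 0) : ¬ LJPlus (lemExOr P R) := by
  have hunipolar : (lemExOr P R).IsUnipolar := fun _ => .inl (by simp [lemExOr, exPred, Occurs])
  intro h
  rcases h.or_elim hunipolar with hem | hR
  · exact not_ljPlus_em_exPred P hem
  · exact hR.holds fun _ _ => False

end DecAtoms

theorem mainTheorem3 (L : FirstOrder.Language.{u, v}) [L.IsRelational] :
    -- LJ⁺ and LJ derive the same unipolar formulas
    (∀ F : DecAtoms.Formula L 0, F.IsUnipolar → (DecAtoms.LJPlus F ↔ DecAtoms.LJ F)) ∧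
    -- the disjunction property of LJ⁺ for unipolar formulas
    (∀ A B : DecAtoms.Formula L 0, (A.or B).IsUnipolar → DecAtoms.LJPlus (A.or B) →
      DecAtoms.LJPlus A ∨ DecAtoms.LJPlus B) ∧
    -- the existence property of LJ⁺ for unipolar formulas
    (∀ A : DecAtoms.Formula L 1, A.ex.IsUnipolar → DecAtoms.LJPlus A.ex →
      ∃ a : ℕ, DecAtoms.LJPlus (A.inst a)) ∧
    -- `(∃x P(x) ∨ ¬∃x P(x)) ∨ R` is derivable in LK but not in LJ⁺
    (∀ (P : L.Relations 1) (R : L.Relations 0),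
      DecAtoms.LK (DecAtoms.lemExOr P R) ∧ ¬ DecAtoms.LJPlus (DecAtoms.lemExOr P R)) ∧
    -- as soon as there is a predicate symbol, LK derives formulas that LJ⁺ does not
    ((∃ k : ℕ, Nonempty (L.Relations (k + 1))) →
      ∃ F : DecAtoms.Formula L 0, DecAtoms.LK F ∧ ¬ DecAtoms.LJPlus F) := by
  refine ⟨fun F hF => ⟨DecAtoms.LJPlus.lj hF, DecAtoms.LJ.ljPlus⟩,
    fun A B => DecAtoms.LJPlus.or_elim, fun A => DecAtoms.LJPlus.exists_inst,
    fun P R => ⟨DecAtoms.lk_lemExOr P R, DecAtoms.not_ljPlus_lemExOr P R⟩, ?_⟩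
  rintro ⟨k, ⟨P⟩⟩
  exact ⟨_, DecAtoms.lk_em _, DecAtoms.not_ljPlus_em_pred P fun _ => Sum.inl 0⟩
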